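/- Let $M$ be a closed connected surface with a (finite, simplicial) triangulation $\mathcal T=(V,E,F)$, $V=\{1,\dots,N\}$, and let $\Phi:E\to[0,\pi/2]$ be a weight on the edges. A circle packing metric is a vector $r\in\mathbb R^N_{>0}$. It gives each edge $\{ij\}\in E$ the length $l_{ij}=\sqrt{r_i^2+r_j^2+2r_ir_j\cos\Phi_{ij}}$; each face $\{ijk\}\in F$ is then realized as a Euclidean triangle with side lengths $l_{ij},l_{ik},l_{jk}$, and $\theta_i^{jk}$ denotes its inner angle at $i$. Put $$K_i=2\pi-\sum_{\{ijk\}\in F}\theta_i^{jk},\qquad R_i=\frac{K_i}{r_i^2},$$ where the sum is over all triangles having $i$ as a vertex. A function $\overline R:V\to\mathbb R$ is called admissible if there is a circle packing metric $\overline r$ whose curvature $R$ equals $\overline R$. The modified flow with respect to $\overline R$ is the system $$\frac{dg_i}{dt}=(\overline R_i-R_i)\,g_i,\qquad g_i=r_i^2,\quad i\in V,\quad t\ge 0,$$ for circle packing metrics $r(t)$. **Theorem.** Let $\overline R:V\to\mathbb R$ be any function. (1) If some solution $r(t)$ of the modified flow exists for all $t\ge0$ and converges, as $t\to+\infty$,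 to a circle packing metric (that is, to a limit in $\mathbb R^N_{>0}$), then $\overline R$ is admissible. (2) Suppose that $\overline R_i\le 0$ for all $i\in V$, that $\overline R$ is not identically zero, and that $\overline R$ is the curvature of a circle packing metric $\overline r$. Then $\overline r$ is the unique metric in $\mathbb R^N_{>0}$ with curvature $\overline R$. Moreover, for every initial circle packing metric $r_0$ the solution $r(t)$ of the modified flow with $r(0)=r_0$ is unique, exists for all $t\ge 0$ and converges exponentially fast to $\overline r$: there are constants $C,c>0$ (depending possibly on $r_0$) with $|r_i(t)-\overline r_i|\le Ce^{-ct}$ for all $t\ge0$ and $i\in V$. -/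

import Mathlib

open scoped Topology

noncomputable section

namespace CirclePacking

variable {V : Type*} [DecidableEq V]

/-- The graph of vertices and edges of a simplicial complex. -/
def edgeGraph (T : AbstractSimplicialComplex V) : SimpleGraph V where
  Adj i j := i ≠ j ∧ {i, j} ∈ T
  symm := ⟨fun i j h => ⟨h.1.symm, by rw [Finset.pair_comm]; exact h.2⟩⟩
  loopless := ⟨fun _ h => h.1 rfl⟩

/-- `i`, `j`, `k` are the three vertices of a triangle (two-dimensional face). -/
def IsTriangle (T : AbstractSimplicialComplex V) (i j k : V) : Prop :=
  i ≠ j ∧ i ≠ k ∧ j ≠ k ∧ {i, j, k} ∈ T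

/-- The link of the vertex `i`: its vertices are the neighbours of `i`, and `j`, `k` are joined
if `i`, `j`, `k` span a triangle. -/
def link (T : AbstractSimplicialComplex V) (i : V) :
    SimpleGraph {j : V // (edgeGraph T).Adj i j} where
  Adj j k := IsTriangle T i j k
  symm := ⟨fun j k h => ⟨h.2.1, h.1, h.2.2.1.symm, by
    rw [Finset.pair_comm (k : V) (j : V)]; exact h.2.2.2⟩⟩
  loopless := ⟨fun _ h => h.2.2.1 rfl⟩

/-- A finite simplicial complex `T` with vertex set `V` is a triangulation of a closed connected
surface: it is connected, its faces have dimension at most two, and the link of every vertex is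
a cycle (a connected graph all of whose vertices have degree two). -/
structure IsClosedSurface (T : AbstractSimplicialComplex V) : Prop where
  connected : (edgeGraph T).Connected
  card_le_three : ∀ s ∈ T, s.card ≤ 3
  link_connected : ∀ i, (link T i).Connected
  link_degree : ∀ i j, ((link T i).neighborSet j).ncard = 2

/-- A weight assigns to every edge a number in `[0, π/2]` (values off the edges play no role). -/
def IsWeight (T : AbstractSimplicialComplex V) (Φ : Sym2 V → ℝ) : Prop :=
  ∀ i j, (edgeGraph T).Adj i j → Φ s(i, j) ∈ Set.Icc 0 (Real.pi / 2)

/-- A circle packing metric is a function `r : V → (0, ∞)`. -/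
def IsCirclePackingMetric (r : V → ℝ) : Prop := ∀ i, 0 < r i

/-- The length `l_ij` of the edge `{i, j}`. -/
def edgeLength (Φ : Sym2 V → ℝ) (r : V → ℝ) (i j : V) : ℝ :=
  √(r i ^ 2 + r j ^ 2 + 2 * r i * r j * Real.cos (Φ s(i, j)))

/-- The inner angle at the vertex `i` of the Euclidean triangle with the side lengths
`l_ij`, `l_ik`, `l_jk`. -/
def innerAngle (Φ : Sym2 V → ℝ) (r : V → ℝ) (i j k : V) : ℝ :=
  Real.arccos ((edgeLength Φ r i j ^ 2 + edgeLength Φ r i k ^ 2 - edgeLength Φ r j k ^ 2) /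
    (2 * edgeLength Φ r i j * edgeLength Φ r i k))

open Classical in
/-- The classical discrete Gauss curvature `K_i`: `2π` minus the sum of the inner angles at `i`
of all triangles that have `i` as a vertex. The double sum meets each triangle `{i, j, k}` twice,
as `(j, k)` and as `(k, j)`, whence the factor `1/2`. -/
def gaussCurvature [Fintype V] (T : AbstractSimplicialComplex V) (Φ : Sym2 V → ℝ) (r : V → ℝ)
    (i : V) : ℝ :=
  2 * Real.pi - (1 / 2) * ∑ j, ∑ k, if IsTriangle T i j k then innerAngle Φ r i j k else 0

/-- The combinatorial curvature `R_i = K_i / r_i ^ 2`. -/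
def curvature [Fintype V] (T : AbstractSimplicialComplex V) (Φ : Sym2 V → ℝ) (r : V → ℝ)
    (i : V) : ℝ :=
  gaussCurvature T Φ r i / r i ^ 2

/-- `Rbar` is the curvature of some circle packing metric. -/
def IsAdmissible [Fintype V] (T : AbstractSimplicialComplex V) (Φ : Sym2 V → ℝ)
    (Rbar : V → ℝ) : Prop :=
  ∃ r : V → ℝ, IsCirclePackingMetric r ∧ ∀ i, curvature T Φ r i = Rbar i

/-- The circle packing metrics `r t`, for `t` in the time interval `I`, solve the modified
combinatorial Ricci flow `dg_i/dt = (Rbar_i - R_i) g_i`, where `g_i = r_i ^ 2`. -/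
def IsModifiedRicciFlow [Fintype V] (T : AbstractSimplicialComplex V) (Φ : Sym2 V → ℝ)
    (Rbar : V → ℝ) (I : Set ℝ) (r : ℝ → V → ℝ) : Prop :=
  ∀ t ∈ I, IsCirclePackingMetric (r t) ∧
    ∀ i, HasDerivWithinAt (fun s => r s i ^ 2)
      ((Rbar i - curvature T Φ (r t) i) * r t i ^ 2) I t

/-- A solution that exists for all times `t ≥ 0` and converges to a circle packing metric. -/
def IsConvergentModifiedRicciFlow [Fintype V] (T : AbstractSimplicialComplex V)
    (Φ : Sym2 V → ℝ) (Rbar : V → ℝ) (r : ℝ → V → ℝ) : Prop :=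
  IsModifiedRicciFlow T Φ Rbar (Set.Ici 0) r ∧
    ∃ rlim : V → ℝ, IsCirclePackingMetric rlim ∧ Filter.Tendsto r Filter.atTop (𝓝 rlim)

/-- Exponentially fast convergence of `r t` to `rbar` as `t → ∞`. -/
def ConvergesExponentially (r : ℝ → V → ℝ) (rbar : V → ℝ) : Prop :=
  ∃ C > 0, ∃ c > 0, ∀ t ≥ (0 : ℝ), ∀ i, |r t i - rbar i| ≤ C * Real.exp (-c * t)

end CirclePacking

end

noncomputable section

namespace CirclePacking

open Set Filter Metric
open scoped NNReal

/-! ### Ordinary differential equations -/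

/-! In the coordinates `u_i = log r_i` the flow is the autonomous C¹ system `u_i' = (Rbar_i - R_i) /
2`. A convergent solution can only converge to a zero of the field, which is (1).

For (2), put `x = u - log rbar`. Each inner angle at `i` is nondecreasing in the log-radii of the
other two vertices relative to `u_i`, so `K_i(u) - K_i(log rbar)` is a weighted Laplacian `∑ w_ij
(x_i - x_j)` with `w ≥ 0` (`exists_gaussCurvature_exp_sub_eq`). Since `R_i = K_i exp (-2 u_i)` and
`Rbar ≤ 0`, the field equals `-a_i x_i - ∑ b_ij (x_i - x_j)` with `a, b ≥ 0`, and `a` is positive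
where `Rbar < 0` (`exists_logField_eq`). The coefficients depend on `x`, but on a bounded set their
bounds do not.

Such a system is only weakly diagonally dominant. Connectedness spreads the strict dominance from
one vertex to all, through weights `φ` (`exists_weights`): the field points strictly into every box
`|x_j| ≤ s φ_j`. The weighted sup norm therefore decays exponentially
(`exists_exponentially_decaying_solution`). The box may be as large as desired, so every initial
metric is covered. A second metric of curvature `Rbar` would be a constant solution that also
converges to `rbar`. -/

theorem exists_solution_Ici_of_lipschitzWith_of_bounded {E : Type*} [NormedAddCommGroup E]
    [NormedSpace ℝ E] [CompleteSpace E] {G : E → E} {K L : ℝ≥0} (hG : LipschitzWith K G)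
    (hL : ∀ x, ‖G x‖ ≤ L) (x₀ : E) :
    ∃ f : ℝ → E, f 0 = x₀ ∧ ∀ t ∈ Ici (0 : ℝ), HasDerivWithinAt f (G (f t)) (Ici 0) t := by
  have hex : ∀ n : ℕ, ∃ f : ℝ → E, f 0 = x₀ ∧
      ∀ t ∈ Icc (0 : ℝ) n, HasDerivWithinAt f (G (f t)) (Icc 0 n) t := by
    intro n
    have hPL : IsPicardLindelof (fun _ => G) (⟨0, le_rfl, n.cast_nonneg⟩ : Icc (0 : ℝ) n) x₀
        (L * n) 0 L K :=
      { lipschitzOnWith := fun _ _ => hG.lipschitzOnWith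
        continuousOn := fun _ _ => continuousOn_const
        norm_le := fun _ _ x _ => hL x
        mul_max_le := by simp }
    exact hPL.exists_eq_forall_mem_Icc_hasDerivWithinAt₀
  choose f hf0 hf using hex
  have hright : ∀ n : ℕ, ∀ b ≤ (n : ℝ), ∀ t ∈ Ico (0 : ℝ) b,
      HasDerivWithinAt (f n) (G (f n t)) (Ici t) t := by
    intro n b hb t ht
    refine (hf n t ⟨ht.1, ht.2.le.trans hb⟩).mono_of_mem_nhdsWithin ?_
    filter_upwards [Icc_mem_nhdsGE (ht.2.trans_le hb)] with u hu
    exact ⟨ht.1.trans hu.1, hu.2⟩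
  have heq : ∀ n m : ℕ, n ≤ m → EqOn (f n) (f m) (Icc 0 n) := by
    intro n m hnm
    have hnm' : (n : ℝ) ≤ m := by exact_mod_cast hnm
    refine ODE_solution_unique (v := fun _ => G) (fun _ => hG)
      (fun t ht => (hf n t ht).continuousWithinAt) (hright n n le_rfl)
      (fun t ht => ?_) (hright m n hnm') (by rw [hf0, hf0])
    exact ((hf m t ⟨ht.1, ht.2.trans hnm'⟩).continuousWithinAt).mono (Icc_subset_Icc_right hnm')
  -- The extra 1 places `t` strictly before the right end of the interval, so the derivative within
  -- `Icc 0 N` is one within `Ici 0`.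
  refine ⟨fun t => f (⌈t⌉₊ + 1) t, hf0 _, fun t ht => ?_⟩
  set N := ⌈t⌉₊ + 1 with hN
  have htN : t < (N : ℝ) := by
    have := Nat.le_ceil t
    push_cast [hN]
    linarith
  have hEq : ∀ s ∈ Icc (0 : ℝ) N, f (⌈s⌉₊ + 1) s = f N s := by
    intro s hs
    have hs' : s ≤ ((⌈s⌉₊ + 1 : ℕ) : ℝ) := by
      push_cast
      linarith [Nat.le_ceil s]
    rcases le_total (⌈s⌉₊ + 1) N with h | h
    · exact heq _ _ h ⟨hs.1, hs'⟩
    · exact (heq _ _ h hs).symm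
  have hd := (hf N t ⟨ht, htN.le⟩).congr (f := f N) (f₁ := fun s => f (⌈s⌉₊ + 1) s) hEq
    (hEq t ⟨ht, htN.le⟩)
  refine hd.mono_of_mem_nhdsWithin ?_
  have : Iio (N : ℝ) ∈ 𝓝[Ici 0] t := mem_nhdsWithin_of_mem_nhds (Iio_mem_nhds htN)
  filter_upwards [this, self_mem_nhdsWithin] with u hu hu'
  exact ⟨hu', le_of_lt hu⟩

/-- First-exit argument: the times at which all coordinates are nonnegative form a closed set, and a
coordinate that vanishes there has positive derivative, so the set extends to the right of each of
its points. -/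
theorem nonneg_of_deriv_pos_of_eq_zero {ι : Type*} [Finite ι] {y y' : ι → ℝ → ℝ}
    (hy : ∀ k, ∀ t ∈ Ici (0 : ℝ), HasDerivWithinAt (y k) (y' k t) (Ici 0) t)
    (h0 : ∀ k, 0 ≤ y k 0)
    (h : ∀ t ∈ Ici (0 : ℝ), (∀ j, 0 ≤ y j t) → ∀ k, y k t = 0 → 0 < y' k t) :
    ∀ t ∈ Ici (0 : ℝ), ∀ k, 0 ≤ y k t := by
  intro b hb
  have hcont : ∀ k, ContinuousOn (y k) (Ici 0) := fun k t ht => (hy k t ht).continuousWithinAt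
  have hsub : Icc 0 b ⊆ {t | ∀ k, 0 ≤ y k t} := by
    refine IsClosed.Icc_subset_of_forall_exists_gt ?_ h0 ?_
    · have : {t | ∀ k, 0 ≤ y k t} ∩ Icc 0 b = Icc 0 b ∩ ⋂ k, (Icc 0 b ∩ y k ⁻¹' Ici 0) := by
        ext t
        simp only [mem_inter_iff, mem_ofPred_eq, mem_iInter, mem_preimage, mem_Ici]
        exact ⟨fun ⟨h1, h2⟩ => ⟨h2, fun k => ⟨h2, h1 k⟩⟩, fun ⟨h1, h2⟩ => ⟨fun k => (h2 k).2, h1⟩⟩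
      rw [this]
      exact isClosed_Icc.inter (isClosed_iInter fun k =>
        ((hcont k).mono Icc_subset_Ici_self).preimage_isClosed_of_isClosed isClosed_Icc isClosed_Ici)
    · rintro t ⟨hts, ht⟩ u hu
      have hev : ∀ᶠ s in 𝓝[>] t, ∀ k, 0 ≤ y k s := by
        rw [eventually_all]
        intro k
        have hd : HasDerivWithinAt (y k) (y' k t) (Ioi t) t :=
          (hy k t ht.1).mono (fun s hs => ht.1.trans (le_of_lt hs))
        rcases (hts k).eq_or_lt with h1 | h1
        · have hpos := h t ht.1 hts k h1.symm
          have hsl := (hasDerivWithinAt_iff_tendsto_slope' (by simp)).1 hd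
          filter_upwards [hsl.eventually (lt_mem_nhds hpos), self_mem_nhdsWithin] with s hs hst
          have hst' : 0 < s - t := sub_pos.2 hst
          rw [slope_def_field, ← h1, sub_zero] at hs
          exact ((div_pos_iff_of_pos_right hst').1 hs).le
        · filter_upwards [hd.continuousWithinAt.eventually (lt_mem_nhds h1)] with s hs using hs.le
      obtain ⟨s, hs1, hs2⟩ := (hev.and (Ioc_mem_nhdsGT hu)).exists
      exact ⟨s, hs1, hs2⟩
  exact hsub ⟨hb, le_rfl⟩

/-! ### Decay in a weighted sup norm, uniqueness and limits of solutions -/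

variable {V : Type*} [Fintype V]

theorem lipschitzWith_sup_inf (a b : V → ℝ) : LipschitzWith 1 fun x : V → ℝ => a ⊔ (b ⊓ x) := by
  refine LipschitzWith.of_dist_le_mul fun x y => ?_
  rw [NNReal.coe_one, one_mul, dist_pi_le_iff dist_nonneg]
  intro i
  have h1 : LipschitzWith 1 fun s : ℝ => max (a i) (min (b i) s) :=
    (LipschitzWith.id.const_min _).const_max _
  have := h1.dist_le_mul (x i) (y i)
  rw [NNReal.coe_one, one_mul] at this
  exact this.trans (dist_le_pi_dist x y i)

/-- The field points inward on the faces of all boxes `|x_j| ≤ s φ_j` with `s ≤ m`. Composing it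
with the clamp to the largest box makes it bounded and Lipschitz, hence globally solvable; the
solution never leaves the box, where the clamp is the identity. -/
theorem exists_exponentially_decaying_solution {F : (V → ℝ) → V → ℝ} (hF : ContDiff ℝ 1 F)
    {m δ : ℝ} {φ : V → ℝ} (hm : 0 < m) (hδ : 0 < δ) (hφ : ∀ i, 0 < φ i)
    (hle : ∀ s, 0 < s → s ≤ m → ∀ x : V → ℝ, (∀ j, |x j| ≤ s * φ j) → ∀ i,
      x i = s * φ i → F x i ≤ -(δ * (s * φ i)))
    (hge : ∀ s, 0 < s → s ≤ m → ∀ x : V → ℝ, (∀ j, |x j| ≤ s * φ j) → ∀ i,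
      x i = -(s * φ i) → δ * (s * φ i) ≤ F x i)
    (x₀ : V → ℝ) (hx₀ : ∀ j, |x₀ j| ≤ m * φ j) :
    ∃ x : ℝ → V → ℝ, x 0 = x₀ ∧
      (∀ t ∈ Ici (0 : ℝ), HasDerivWithinAt x (F (x t)) (Ici 0) t) ∧
      ∀ t ∈ Ici (0 : ℝ), ∀ j, |x t j| ≤ m * Real.exp (-(δ / 2) * t) * φ j := by
  set w : V → ℝ := fun j => m * φ j with hw
  have hw0 : ∀ j, 0 < w j := fun j => mul_pos hm (hφ j)
  set P : (V → ℝ) → V → ℝ := fun x => (-w) ⊔ (w ⊓ x) with hP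
  have hPmem : ∀ x, P x ∈ Icc (-w) w := fun x =>
    ⟨le_sup_left, sup_le (fun j => by have := hw0 j; simp only [Pi.neg_apply]; linarith) inf_le_left⟩
  have hPid : ∀ x : V → ℝ, (∀ j, |x j| ≤ w j) → P x = x := by
    intro x hx
    have h1 : x ≤ w := fun j => (abs_le.1 (hx j)).2
    have h2 : -w ≤ x := fun j => (abs_le.1 (hx j)).1
    simp only [hP, inf_eq_right.2 h1, sup_eq_right.2 h2]
  obtain ⟨K, hK⟩ := hF.contDiffOn.exists_lipschitzOnWith (s := Icc (-w) w) one_ne_zero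
    (convex_Icc _ _) isCompact_Icc
  have hlip : LipschitzWith (K * 1) (F ∘ P) := by
    rw [← lipschitzOnWith_univ]
    exact hK.comp (lipschitzWith_sup_inf _ _).lipschitzOnWith (fun x _ => hPmem x)
  obtain ⟨L, hL⟩ := (isCompact_Icc (a := -w) (b := w)).exists_bound_of_continuousOn
    hF.continuous.continuousOn
  obtain ⟨x, hx0, hx⟩ := exists_solution_Ici_of_lipschitzWith_of_bounded (L := L.toNNReal) hlip
    (fun x => (hL _ (hPmem x)).trans (Real.le_coe_toNNReal L)) x₀
  have hbound : ∀ t ∈ Ici (0 : ℝ), ∀ j, |x t j| ≤ m * Real.exp (-(δ / 2) * t) * φ j := by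
    set e : ℝ → ℝ := fun t => m * Real.exp (-(δ / 2) * t) with he
    have hed : ∀ t, HasDerivAt e (-(δ / 2) * e t) t := by
      intro t
      have := (((hasDerivAt_id t).const_mul (-(δ / 2))).exp).const_mul m
      refine this.congr_deriv ?_
      simp only [he, id]
      ring
    have he0 : ∀ t, 0 < e t := fun t => mul_pos hm (Real.exp_pos _)
    have hem : ∀ t ∈ Ici (0 : ℝ), e t ≤ m := by
      intro t ht
      have : Real.exp (-(δ / 2) * t) ≤ 1 := Real.exp_le_one_iff.2 (by
        have := mul_nonneg hδ.le (mem_Ici.1 ht); linarith)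
      simpa [he] using mul_le_mul_of_nonneg_left this hm.le
    have hxi : ∀ i, ∀ t ∈ Ici (0 : ℝ),
        HasDerivWithinAt (fun s => x s i) (F (P (x t)) i) (Ici 0) t :=
      fun i t ht => (hasDerivWithinAt_pi.1 (hx t ht)) i
    -- The barriers `± e t * φ` shrink at rate `δ / 2`, slower than the available rate `δ`; this
    -- makes the derivative at a contact strictly positive.
    have key := nonneg_of_deriv_pos_of_eq_zero (ι := V ⊕ V)
      (y := Sum.elim (fun i t => e t * φ i - x t i) (fun i t => e t * φ i + x t i))
      (y' := Sum.elim (fun i t => -(δ / 2) * e t * φ i - F (P (x t)) i)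
        (fun i t => -(δ / 2) * e t * φ i + F (P (x t)) i))
      (by
        rintro (i | i) t ht
        · exact ((hed t).hasDerivWithinAt.mul_const _).sub (hxi i t ht)
        · exact ((hed t).hasDerivWithinAt.mul_const _).add (hxi i t ht))
      (by
        rintro (i | i)
        · have := (abs_le.1 (hx₀ i)).2
          simp [he, hx0, this]
        · have := (abs_le.1 (hx₀ i)).1
          simp only [he, Sum.elim_inr, mul_zero, Real.exp_zero, mul_one, hx0]
          linarith)
      (by
        intro t ht hnn
        have hab : ∀ j, |x t j| ≤ e t * φ j := fun j => by
          have h1 := hnn (Sum.inl j)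
          have h2 := hnn (Sum.inr j)
          simp only [Sum.elim_inl, Sum.elim_inr] at h1 h2
          exact abs_le.2 ⟨by linarith, by linarith⟩
        have hPx : P (x t) = x t := hPid _ fun j =>
          (hab j).trans (mul_le_mul_of_nonneg_right (hem t ht) (hφ j).le)
        rintro (i | i) hi <;> simp only [Sum.elim_inl, Sum.elim_inr] at hi ⊢ <;> rw [hPx]
        · have := hle (e t) (he0 t) (hem t ht) (x t) hab i (by linarith)
          have hp := mul_pos hδ (mul_pos (he0 t) (hφ i))
          nlinarith
        · have := hge (e t) (he0 t) (hem t ht) (x t) hab i (by linarith)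
          have hp := mul_pos hδ (mul_pos (he0 t) (hφ i))
          nlinarith)
    intro t ht j
    have h1 := key t ht (Sum.inl j)
    have h2 := key t ht (Sum.inr j)
    simp only [Sum.elim_inl, Sum.elim_inr] at h1 h2
    exact abs_le.2 ⟨by linarith, by linarith⟩
  refine ⟨x, hx0, fun t ht => ?_, hbound⟩
  have hPx : P (x t) = x t := hPid _ fun j => (hbound t ht j).trans (by
    refine mul_le_mul_of_nonneg_right ?_ (hφ j).le
    have : Real.exp (-(δ / 2) * t) ≤ 1 := Real.exp_le_one_iff.2 (by
        have := mul_nonneg hδ.le (mem_Ici.1 ht); linarith)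
    simpa using mul_le_mul_of_nonneg_left this hm.le)
  have := hx t ht
  rwa [Function.comp_apply, hPx] at this

/-- A C¹ field is Lipschitz on a ball containing both trajectories up to a given time before `τ`,
which suffices for uniqueness. -/
theorem eqOn_of_contDiff_of_hasDerivWithinAt {F : (V → ℝ) → V → ℝ} (hF : ContDiff ℝ 1 F) {τ : ℝ}
    {x y : ℝ → V → ℝ} (hx : ∀ t ∈ Ico 0 τ, HasDerivWithinAt x (F (x t)) (Ico 0 τ) t)
    (hy : ∀ t ∈ Ico 0 τ, HasDerivWithinAt y (F (y t)) (Ico 0 τ) t) (h0 : x 0 = y 0) :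
    EqOn x y (Ico 0 τ) := by
  intro T hT
  have hsub : Icc 0 T ⊆ Ico 0 τ := fun t ht => ⟨ht.1, ht.2.trans_lt hT.2⟩
  have hc : ∀ z : ℝ → V → ℝ, (∀ t ∈ Ico 0 τ, HasDerivWithinAt z (F (z t)) (Ico 0 τ) t) →
      ContinuousOn z (Icc 0 T) ∧ ∀ t ∈ Ico 0 T, HasDerivWithinAt z (F (z t)) (Ici t) t := by
    refine fun z hz => ⟨fun t ht => ((hz t (hsub ht)).mono hsub).continuousWithinAt, fun t ht => ?_⟩
    have htτ : t < τ := ht.2.trans hT.2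
    refine (hz t ⟨ht.1, htτ⟩).mono_of_mem_nhdsWithin ?_
    filter_upwards [Ico_mem_nhdsGE htτ] with u hu using ⟨ht.1.trans hu.1, hu.2⟩
  obtain ⟨hxc, hx'⟩ := hc x hx
  obtain ⟨hyc, hy'⟩ := hc y hy
  obtain ⟨M, hM⟩ := isCompact_Icc.exists_bound_of_continuousOn hxc
  obtain ⟨N, hN⟩ := isCompact_Icc.exists_bound_of_continuousOn hyc
  obtain ⟨K, hK⟩ := hF.contDiffOn.exists_lipschitzOnWith (s := closedBall 0 (max M N)) one_ne_zero
    (convex_closedBall _ _) (isCompact_closedBall _ _)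
  refine ODE_solution_unique_of_mem_Icc_right (v := fun _ => F) (K := K)
    (s := fun _ => closedBall 0 (max M N)) (fun _ _ => hK) hxc hx' (fun t ht => ?_) hyc hy'
    (fun t ht => ?_) h0 ⟨hT.1, le_rfl⟩
  · exact mem_closedBall_zero_iff.2 ((hM t (Ico_subset_Icc_self ht)).trans (le_max_left _ _))
  · exact mem_closedBall_zero_iff.2 ((hN t (Ico_subset_Icc_self ht)).trans (le_max_right _ _))

/-- If a function and its derivative both converge at infinity, then the derivative tends to `0`. -/
theorem eq_zero_of_tendsto_of_tendsto_deriv {f f' : ℝ → ℝ} {a b : ℝ}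
    (hf : ∀ t ∈ Ici (0 : ℝ), HasDerivWithinAt f (f' t) (Ici 0) t)
    (ha : Tendsto f atTop (𝓝 a)) (hb : Tendsto f' atTop (𝓝 b)) : b = 0 := by
  have hmv : ∀ n : ℕ, ∃ c ∈ Ioo (n : ℝ) (n + 1), f' c = f (n + 1) - f n := by
    intro n
    have hn : (0 : ℝ) ≤ n := n.cast_nonneg
    obtain ⟨c, hc, h⟩ := exists_hasDerivAt_eq_slope f f' (lt_add_one (n : ℝ))
      (fun t ht => ((hf t (hn.trans ht.1)).continuousWithinAt).mono
        fun s hs => hn.trans hs.1)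
      (fun t ht => (hf t (hn.trans ht.1.le)).hasDerivAt (Ici_mem_nhds (hn.trans_lt ht.1)))
    exact ⟨c, hc, by rw [h]; simp⟩
  choose c hc hfc using hmv
  have hcT : Tendsto c atTop atTop :=
    tendsto_atTop_mono (fun n => (hc n).1.le) tendsto_natCast_atTop_atTop
  have h1 : Tendsto (fun n : ℕ => f (n + 1) - f n) atTop (𝓝 (a - a)) :=
    (ha.comp (tendsto_atTop_add_const_right _ _ tendsto_natCast_atTop_atTop)).sub
      (ha.comp tendsto_natCast_atTop_atTop)
  rw [sub_self] at h1
  refine tendsto_nhds_unique (hb.comp hcT) (h1.congr fun n => ?_)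
  exact (hfc n).symm

end CirclePacking
end

noncomputable section

namespace CirclePacking

open Set Filter Metric

/-! ### The angle of a triangle of circles -/

/-- `l_ij l_ik cos θ_i` for a triangle of circles with radii `1`, `b`, `c` and the inversive
distances `α`, `β`, `γ` opposite to the vertices `i`, `j`, `k`. -/
def angleNum (α β γ b c : ℝ) : ℝ := 1 + b * γ + c * β - b * c * α

/-- `(l_ij l_ik sin θ_i) ^ 2`, see `angleNum`. -/
def angleDisc (α β γ b c : ℝ) : ℝ :=
  b ^ 2 * (1 - γ ^ 2) + c ^ 2 * (1 - β ^ 2) + b ^ 2 * c ^ 2 * (1 - α ^ 2) +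
    2 * b * c * (α + β * γ) + 2 * b ^ 2 * c * (β + α * γ) + 2 * b * c ^ 2 * (γ + α * β)

/-- The angle `θ_i` as a function of the ratios of the radii. -/
def triAngle (α β γ b c : ℝ) : ℝ :=
  Real.pi / 2 - Real.arctan (angleNum α β γ b c / √(angleDisc α β γ b c))

/-- The logarithmic derivative of `triAngle` with respect to `b`. -/
def triAngleDeriv (α β γ b c : ℝ) : ℝ :=
  b * (b * (1 - γ ^ 2) + c * (α + β * γ) + b * c * (β + α * γ)) /
    ((1 + b ^ 2 + 2 * b * γ) * √(angleDisc α β γ b c))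

variable {α β γ : ℝ}

/-- This is `sin² + cos² = 1` times `(l_ij l_ik)²`, for `r_i = 1`. -/
theorem angleDisc_add_sq (α β γ b c : ℝ) :
    angleDisc α β γ b c + angleNum α β γ b c ^ 2 =
      (1 + b ^ 2 + 2 * b * γ) * (1 + c ^ 2 + 2 * c * β) := by
  simp only [angleDisc, angleNum]
  ring

theorem angleDisc_swap (α β γ b c : ℝ) : angleDisc α β γ b c = angleDisc α γ β c b := by
  simp only [angleDisc]
  ring

theorem triAngle_swap (α β γ b c : ℝ) : triAngle α β γ b c = triAngle α γ β c b := by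
  have : angleNum α β γ b c = angleNum α γ β c b := by
    simp only [angleNum]
    ring
  rw [triAngle, triAngle, angleDisc_swap, this]

theorem one_sub_sq_nonneg {x : ℝ} (h : x ∈ Icc (0 : ℝ) 1) : 0 ≤ 1 - x ^ 2 := by
  nlinarith [h.1, h.2]

theorem one_sub_sq_pos {x : ℝ} (h : x ∈ Icc (0 : ℝ) 1) (hx : x ≠ 1) : 0 < 1 - x ^ 2 := by
  have := lt_of_le_of_ne h.2 hx
  nlinarith [h.1]

/-- All six terms are nonnegative; the last is positive if `γ = 1`, the first otherwise. Positivity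
means that the triangle does not collapse. -/
theorem angleDisc_pos (hα : α ∈ Icc (0 : ℝ) 1) (hβ : β ∈ Icc (0 : ℝ) 1) (hγ : γ ∈ Icc (0 : ℝ) 1)
    {b c : ℝ} (hb : 0 < b) (hc : 0 < c) : 0 < angleDisc α β γ b c := by
  have h1 := one_sub_sq_nonneg hα
  have h2 := one_sub_sq_nonneg hβ
  have h3 := one_sub_sq_nonneg hγ
  have hα0 := hα.1
  have hβ0 := hβ.1
  have hγ0 := hγ.1
  unfold angleDisc
  by_cases hγ1 : γ = 1
  · have : 0 < γ + α * β := by rw [hγ1]; positivity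
    positivity
  · have := one_sub_sq_pos hγ hγ1
    positivity

theorem sq_side_pos (hγ : γ ∈ Icc (0 : ℝ) 1) {b : ℝ} (hb : 0 < b) :
    0 < 1 + b ^ 2 + 2 * b * γ := by
  have := hγ.1
  positivity

theorem hasDerivAt_triAngle_exp (hα : α ∈ Icc (0 : ℝ) 1) (hβ : β ∈ Icc (0 : ℝ) 1)
    (hγ : γ ∈ Icc (0 : ℝ) 1) {c : ℝ} (hc : 0 < c) (p : ℝ) :
    HasDerivAt (fun p => triAngle α β γ (Real.exp p) c) (triAngleDeriv α β γ (Real.exp p) c) p := by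
  have hb : 0 < Real.exp p := Real.exp_pos p
  have hD := angleDisc_pos hα hβ hγ hb hc
  have hsq := Real.sq_sqrt hD.le
  have hs := Real.sqrt_pos.2 hD
  have hP := sq_side_pos hγ hb
  have hQ := sq_side_pos hβ hc
  set b := Real.exp p with hbdef
  have hn : HasDerivAt (fun b => angleNum α β γ b c) (γ - c * α) b := by
    unfold angleNum
    have := (((hasDerivAt_id b).mul_const γ).const_add 1 |>.add_const (c * β)).sub
      (((hasDerivAt_id b).mul_const c).mul_const α)
    exact this.congr_deriv (by ring)
  have hd : HasDerivAt (fun b => angleDisc α β γ b c)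
      (2 * b * (1 - γ ^ 2) + 2 * b * c ^ 2 * (1 - α ^ 2) + 2 * c * (α + β * γ)
        + 4 * b * c * (β + α * γ) + 2 * c ^ 2 * (γ + α * β)) b := by
    unfold angleDisc
    have h1 := hasDerivAt_id b
    have h2 : HasDerivAt (fun b : ℝ => b ^ 2) (2 * b) b := by simpa using hasDerivAt_pow 2 b
    have := (((((h2.mul_const (1 - γ ^ 2)).add_const (c ^ 2 * (1 - β ^ 2))).add
      ((h2.mul_const (c ^ 2)).mul_const (1 - α ^ 2))).add
      (((h1.const_mul 2).mul_const c).mul_const (α + β * γ))).add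
      (((h2.const_mul 2).mul_const c).mul_const (β + α * γ))).add
      (((h1.const_mul 2).mul_const (c ^ 2)).mul_const (γ + α * β))
    exact this.congr_deriv (by ring)
  have hang := ((hn.div (hd.sqrt hD.ne') hs.ne').arctan.const_sub (Real.pi / 2))
  have := hang.comp p (Real.hasDerivAt_exp p)
  refine this.congr_deriv ?_
  have hsum := angleDisc_add_sq α β γ b c
  have hne : (1 + b ^ 2 + 2 * b * γ) * (1 + c ^ 2 + 2 * c * β) ≠ 0 := (mul_pos hP hQ).ne'
  have key : (1 + b ^ 2 + 2 * b * γ) * (1 + c ^ 2 + 2 * c * β) =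
      √(angleDisc α β γ b c) ^ 2 + angleNum α β γ b c ^ 2 := by rw [hsq, ← hsum]
  have hfrac : 1 / (1 + (angleNum α β γ b c / √(angleDisc α β γ b c)) ^ 2) =
      √(angleDisc α β γ b c) ^ 2 / ((1 + b ^ 2 + 2 * b * γ) * (1 + c ^ 2 + 2 * c * β)) := by
    rw [key]
    field_simp
  simp only [Pi.div_apply, ← hbdef, triAngleDeriv]
  rw [hfrac]
  set s := √(angleDisc α β γ b c) with hsdef
  -- The numerator of the quotient rule contains the factor `1 + c ^ 2 + 2 * c * β`, which cancels
  -- against the denominator and leaves `triAngleDeriv`.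
  have hN : angleNum α β γ b c *
      (2 * b * (1 - γ ^ 2) + 2 * b * c ^ 2 * (1 - α ^ 2) + 2 * c * (α + β * γ)
        + 4 * b * c * (β + α * γ) + 2 * c ^ 2 * (γ + α * β)) - 2 * (γ - c * α) * s ^ 2 =
      2 * (b * (1 - γ ^ 2) + c * (α + β * γ) + b * c * (β + α * γ)) *
        (1 + c ^ 2 + 2 * c * β) := by
    rw [hsq]
    simp only [angleNum, angleDisc]
    ring
  generalize angleNum α β γ b c = n at *
  generalize (2 * b * (1 - γ ^ 2) + 2 * b * c ^ 2 * (1 - α ^ 2) + 2 * c * (α + β * γ)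
        + 4 * b * c * (β + α * γ) + 2 * c ^ 2 * (γ + α * β)) = d at *
  generalize (b * (1 - γ ^ 2) + c * (α + β * γ) + b * c * (β + α * γ)) = N at *
  generalize 1 + b ^ 2 + 2 * b * γ = P at *
  generalize 1 + c ^ 2 + 2 * c * β = Q at *
  field_simp
  linear_combination hN

theorem triAngleDeriv_nonneg (hα : α ∈ Icc (0 : ℝ) 1) (hβ : β ∈ Icc (0 : ℝ) 1)
    (hγ : γ ∈ Icc (0 : ℝ) 1) {b c : ℝ} (hb : 0 < b) (hc : 0 < c) :
    0 ≤ triAngleDeriv α β γ b c := by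
  have h3 := one_sub_sq_nonneg hγ
  have hα0 := hα.1
  have hβ0 := hβ.1
  have hγ0 := hγ.1
  unfold triAngleDeriv
  positivity

theorem triAngleDeriv_pos (hα : α ∈ Icc (0 : ℝ) 1) (hβ : β ∈ Icc (0 : ℝ) 1)
    (hγ : γ ∈ Icc (0 : ℝ) 1) (hnd : ¬(γ = 1 ∧ α = 0 ∧ β = 0)) {b c : ℝ} (hb : 0 < b) (hc : 0 < c) :
    0 < triAngleDeriv α β γ b c := by
  have h3 := one_sub_sq_nonneg hγ
  have hα0 := hα.1
  have hβ0 := hβ.1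
  have hγ0 := hγ.1
  have hD := Real.sqrt_pos.2 (angleDisc_pos hα hβ hγ hb hc)
  have hP := sq_side_pos hγ hb
  have : 0 < b * (1 - γ ^ 2) + c * (α + β * γ) + b * c * (β + α * γ) := by
    by_cases hγ1 : γ = 1
    · rcases hα0.eq_or_lt with h | h
      · rcases hβ0.eq_or_lt with h' | h'
        · exact absurd ⟨hγ1, h.symm, h'.symm⟩ hnd
        · positivity
      · positivity
    · have := one_sub_sq_pos hγ hγ1
      positivity
  unfold triAngleDeriv
  positivity

theorem continuous_triAngleDeriv_exp (hα : α ∈ Icc (0 : ℝ) 1) (hβ : β ∈ Icc (0 : ℝ) 1)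
    (hγ : γ ∈ Icc (0 : ℝ) 1) :
    Continuous fun z : ℝ × ℝ => triAngleDeriv α β γ (Real.exp z.1) (Real.exp z.2) := by
  unfold triAngleDeriv
  refine Continuous.div (by fun_prop) ?_ fun z => ?_
  · unfold angleDisc
    fun_prop
  · exact (mul_pos (sq_side_pos hγ (Real.exp_pos _)) (Real.sqrt_pos.2
      (angleDisc_pos hα hβ hγ (Real.exp_pos _) (Real.exp_pos _)))).ne'

theorem contDiff_triAngle_exp (hα : α ∈ Icc (0 : ℝ) 1) (hβ : β ∈ Icc (0 : ℝ) 1)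
    (hγ : γ ∈ Icc (0 : ℝ) 1) :
    ContDiff ℝ 1 fun z : ℝ × ℝ => triAngle α β γ (Real.exp z.1) (Real.exp z.2) := by
  have hD : ∀ z : ℝ × ℝ, angleDisc α β γ (Real.exp z.1) (Real.exp z.2) ≠ 0 :=
    fun z => (angleDisc_pos hα hβ hγ (Real.exp_pos _) (Real.exp_pos _)).ne'
  have h1 : ContDiff ℝ 1 fun z : ℝ × ℝ => angleNum α β γ (Real.exp z.1) (Real.exp z.2) := by
    unfold angleNum
    fun_prop
  have h2 : ContDiff ℝ 1 fun z : ℝ × ℝ => angleDisc α β γ (Real.exp z.1) (Real.exp z.2) := by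
    unfold angleDisc
    fun_prop
  unfold triAngle
  exact contDiff_const.sub (Real.contDiff_arctan.comp
    (h1.div (h2.sqrt hD) fun z => Real.sqrt_ne_zero'.2 (lt_of_le_of_ne'
      (angleDisc_pos hα hβ hγ (Real.exp_pos _) (Real.exp_pos _)).le (hD z))))

/-- Replaces arccos, singular at `±1`, by a smooth expression in `n` and `D > 0`. -/
theorem arccos_div_sqrt {n P Q D : ℝ} (hP : 0 < P) (hQ : 0 < Q) (hD : 0 < D)
    (h : D + n ^ 2 = P * Q) :
    Real.arccos (n / (√P * √Q)) = Real.pi / 2 - Real.arctan (n / √D) := by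
  rw [Real.arccos, Real.arctan_eq_arcsin, ← Real.sqrt_mul hP.le]
  congr 2
  have hs := Real.sqrt_pos.2 hD
  have : 1 + (n / √D) ^ 2 = P * Q / D := by
    rw [div_pow, Real.sq_sqrt hD.le, ← h]
    field_simp
  rw [this, Real.sqrt_div (mul_pos hP hQ).le]
  field_simp

/-- The slope of the angle in each of its variables is bounded above, and away from zero unless
the inversive distances are degenerate. -/
theorem exists_triAngle_exp_sub_eq (hα : α ∈ Icc (0 : ℝ) 1) (hβ : β ∈ Icc (0 : ℝ) 1)
    (hγ : γ ∈ Icc (0 : ℝ) 1) (M : ℝ) :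
    ∃ K, 0 < K ∧ ∀ p ∈ Icc (-M) M, ∀ p' ∈ Icc (-M) M, ∀ q ∈ Icc (-M) M, ∃ A, 0 ≤ A ∧ A ≤ K ∧
      (¬(γ = 1 ∧ α = 0 ∧ β = 0) → 1 ≤ K * A) ∧
      triAngle α β γ (Real.exp p) (Real.exp q) - triAngle α β γ (Real.exp p') (Real.exp q) =
        A * (p - p') := by
  set S : Set (ℝ × ℝ) := Icc (-M) M ×ˢ Icc (-M) M with hS
  have hSc : IsCompact S := isCompact_Icc.prod isCompact_Icc
  set g : ℝ × ℝ → ℝ := fun z => triAngleDeriv α β γ (Real.exp z.1) (Real.exp z.2) with hg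
  have hgc : Continuous g := continuous_triAngleDeriv_exp hα hβ hγ
  have hg0 : ∀ z, 0 ≤ g z := fun z =>
    triAngleDeriv_nonneg hα hβ hγ (Real.exp_pos _) (Real.exp_pos _)
  obtain ⟨C, hC⟩ := hSc.exists_bound_of_continuousOn hgc.continuousOn
  -- Off the degenerate case the derivative is continuous and positive, so its inverse is bounded on
  -- the compact square.
  have hlow : ∃ B, 0 < B ∧ ∀ z ∈ S, ¬(γ = 1 ∧ α = 0 ∧ β = 0) → 1 ≤ B * g z := by
    by_cases hnd : ¬(γ = 1 ∧ α = 0 ∧ β = 0)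
    · have hpos : ∀ z, 0 < g z := fun z =>
        triAngleDeriv_pos hα hβ hγ hnd (Real.exp_pos _) (Real.exp_pos _)
      obtain ⟨B, hB⟩ := hSc.exists_bound_of_continuousOn
        (hgc.inv₀ fun z => (hpos z).ne').continuousOn
      refine ⟨max B 1, by positivity, fun z hz _ => ?_⟩
      have h1 := (Real.norm_of_nonneg (inv_nonneg.2 (hg0 z))).symm.trans_le (hB z hz)
      rw [← inv_mul_cancel₀ (hpos z).ne']
      exact mul_le_mul_of_nonneg_right (h1.trans (le_max_left _ _)) (hg0 z)
    · exact ⟨1, one_pos, fun z _ h => absurd h hnd⟩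
  obtain ⟨B, hB0, hB⟩ := hlow
  have hK : ∀ z ∈ S, 0 ≤ g z ∧ g z ≤ max B C ∧
      (¬(γ = 1 ∧ α = 0 ∧ β = 0) → 1 ≤ max B C * g z) := fun z hz =>
    ⟨hg0 z, ((le_abs_self _).trans (hC z hz)).trans (le_max_right _ _), fun h =>
      (hB z hz h).trans (mul_le_mul_of_nonneg_right (le_max_left _ _) (hg0 z))⟩
  refine ⟨max B C, lt_max_of_lt_left hB0, fun p hp p' hp' q hq => ?_⟩
  have hderiv : ∀ p, HasDerivAt (fun p => triAngle α β γ (Real.exp p) (Real.exp q)) (g (p, q)) p :=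
    fun p => hasDerivAt_triAngle_exp hα hβ hγ (Real.exp_pos q) p
  have hmv : ∀ a b : ℝ, a ∈ Icc (-M) M → b ∈ Icc (-M) M → a < b → ∃ x ∈ Icc (-M) M,
      triAngle α β γ (Real.exp b) (Real.exp q) - triAngle α β γ (Real.exp a) (Real.exp q) =
        g (x, q) * (b - a) := by
    intro a b ha hb hab
    obtain ⟨x, hx, h⟩ := exists_hasDerivAt_eq_slope _ _ hab
      (fun x _ => (hderiv x).continuousAt.continuousWithinAt) (fun x _ => hderiv x)
    refine ⟨x, ⟨ha.1.trans hx.1.le, hx.2.le.trans hb.2⟩, ?_⟩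
    rw [h, div_mul_cancel₀ _ (sub_pos.2 hab).ne']
  rcases lt_trichotomy p p' with h | h | h
  · obtain ⟨x, hx, he⟩ := hmv p p' hp hp' h
    obtain ⟨k1, k2, k3⟩ := hK (x, q) ⟨hx, hq⟩
    exact ⟨_, k1, k2, k3, by linear_combination -he⟩
  · obtain ⟨k1, k2, k3⟩ := hK (p, q) ⟨hp, hq⟩
    exact ⟨_, k1, k2, k3, by rw [h]; ring⟩
  · obtain ⟨x, hx, he⟩ := hmv p' p hp' hp h
    obtain ⟨k1, k2, k3⟩ := hK (x, q) ⟨hx, hq⟩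
    exact ⟨_, k1, k2, k3, he⟩

end CirclePacking
end

noncomputable section

namespace CirclePacking

open Set Filter Metric

/-! ### Weights for a uniformly weakly diagonally dominant system -/

theorem exists_adj_dist_lt {V : Type*} {H : SimpleGraph V} (hH : H.Preconnected) {i v : V}
    (h : i ≠ v) : ∃ j, H.Adj i j ∧ H.dist j v < H.dist i v := by
  obtain ⟨p, hp⟩ := (hH i v).exists_walk_length_eq_dist
  cases p with
  | nil => exact absurd rfl h
  | cons hadj q =>
    refine ⟨_, hadj, ?_⟩
    have := SimpleGraph.dist_le q
    rw [SimpleGraph.Walk.length_cons] at hp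
    omega

/-- The weights `1 - ε ^ (dist + 1)` increase with the distance `h` to `v`. For `i ≠ v` a neighbour
nearer to `v` contributes at least `ε ^ h / (2K)`, while all other terms together lose at most `n K
ε ^ (h + 1) ≤ ε ^ h / (4K)`; at `v` the term `a * φ v` plays the part of the neighbour. `δ` and `φ`
depend on the coefficients only through `K`, as is needed when these vary with the point. -/
theorem exists_weights {V : Type*} [Fintype V] {H : SimpleGraph V} (hH : H.Preconnected) (v : V)
    {K : ℝ} (hK : 0 < K) :
    ∃ δ, 0 < δ ∧ ∃ φ : V → ℝ, (∀ i, 1 / 2 ≤ φ i ∧ φ i ≤ 1) ∧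
      ∀ i, ∀ a, 0 ≤ a → ∀ b : V → ℝ, (∀ j, 0 ≤ b j ∧ b j ≤ K) → (i = v → 1 ≤ K * a) →
        (∀ j, H.Adj i j → 1 ≤ K * b j) → δ ≤ a * φ i + ∑ j, b j * (φ i - φ j) := by
  classical
  set n : ℝ := (Fintype.card V : ℝ) with hn
  have hn0 : 0 ≤ n := Nat.cast_nonneg _
  set ε : ℝ := min (1 / 2) (1 / (4 * (n + 1) * K ^ 2)) with hε
  have hε0 : 0 < ε := lt_min (by norm_num) (by positivity)
  have hε1 : ε ≤ 1 / 2 := min_le_left _ _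
  have hε2 : n * K * ε ≤ 1 / (4 * K) := by
    have h1 : ε ≤ 1 / (4 * (n + 1) * K ^ 2) := min_le_right _ _
    calc n * K * ε ≤ (n + 1) * K * (1 / (4 * (n + 1) * K ^ 2)) := by
          gcongr
          linarith
      _ = 1 / (4 * K) := by field_simp
  obtain ⟨N, hN⟩ := Finite.exists_le fun i => H.dist i v
  have hpow : ∀ k : ℕ, 0 < ε ^ k := fun k => pow_pos hε0 k
  refine ⟨ε ^ N / (4 * K), by positivity, fun i => 1 - ε ^ (H.dist i v + 1), fun i => ⟨?_, ?_⟩, ?_⟩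
  · have : ε ^ (H.dist i v + 1) ≤ ε := pow_le_of_le_one hε0.le (by linarith) (Nat.succ_ne_zero _)
    linarith
  · linarith [hpow (H.dist i v + 1)]
  · intro i a ha b hb hav hbj
    set h := H.dist i v with hh
    have hφ : 1 / 2 ≤ 1 - ε ^ (h + 1) := by
      have : ε ^ (h + 1) ≤ ε := pow_le_of_le_one hε0.le (by linarith) (Nat.succ_ne_zero _)
      linarith
    have hterm : ∀ j, -(K * ε ^ (h + 1)) ≤
        b j * (1 - ε ^ (h + 1) - (1 - ε ^ (H.dist j v + 1))) := by
      intro j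
      have h1 := mul_le_mul_of_nonneg_right (hb j).2 (hpow (h + 1)).le
      have h2 := mul_nonneg (hb j).1 (hpow (H.dist j v + 1)).le
      nlinarith
    have hle : ε ^ N ≤ ε ^ h := pow_le_pow_of_le_one hε0.le (by linarith) (hN i)
    have hsmall : n * (K * ε ^ (h + 1)) ≤ ε ^ h * (1 / (4 * K)) := by
      calc n * (K * ε ^ (h + 1)) = ε ^ h * (n * K * ε) := by ring
        _ ≤ _ := by gcongr
    have hgoal : ε ^ N / (4 * K) ≤ ε ^ h * (1 / (4 * K)) := by
      rw [div_eq_mul_one_div]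
      gcongr
    refine hgoal.trans ?_
    have h12 : ε ^ h * (1 / (2 * K)) = ε ^ h * (1 / (4 * K)) + ε ^ h * (1 / (4 * K)) := by
      field_simp
      norm_num
    by_cases hiv : i = v
    · have hsum : -(n * (K * ε ^ (h + 1))) ≤
          ∑ j, b j * (1 - ε ^ (h + 1) - (1 - ε ^ (H.dist j v + 1))) := by
        have := Finset.card_nsmul_le_sum Finset.univ _ _ fun j _ => hterm j
        rw [nsmul_eq_mul, Finset.card_univ] at this
        linarith
      have h0 : h = 0 := by rw [hh, hiv, SimpleGraph.dist_self]
      have haφ : ε ^ h * (1 / (2 * K)) ≤ a * (1 - ε ^ (h + 1)) := by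
        have h3 : 1 / K ≤ a := (div_le_iff₀' hK).2 (hav hiv)
        calc ε ^ h * (1 / (2 * K)) = 1 / K * (1 / 2) := by rw [h0]; field_simp
          _ ≤ _ := by gcongr
      linarith
    · obtain ⟨j₀, hadj, hlt⟩ := exists_adj_dist_lt hH hiv
      have haφ : 0 ≤ a * (1 - ε ^ (h + 1)) := mul_nonneg ha (by linarith)
      have hj₀ : ε ^ h * (1 / (2 * K)) ≤
          b j₀ * (1 - ε ^ (h + 1) - (1 - ε ^ (H.dist j₀ v + 1))) := by
        have h3 : 1 / K ≤ b j₀ := (div_le_iff₀' hK).2 (hbj j₀ hadj)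
        have h4 : ε ^ h ≤ ε ^ (H.dist j₀ v + 1) :=
          pow_le_pow_of_le_one hε0.le (by linarith) hlt
        have h5 : ε ^ h * (1 / 2) ≤ 1 - ε ^ (h + 1) - (1 - ε ^ (H.dist j₀ v + 1)) := by
          have : ε ^ (h + 1) ≤ ε ^ h * (1 / 2) := by
            rw [pow_succ]
            exact mul_le_mul_of_nonneg_left hε1 (hpow h).le
          linarith
        calc ε ^ h * (1 / (2 * K)) = 1 / K * (ε ^ h * (1 / 2)) := by field_simp
          _ ≤ _ := mul_le_mul h3 h5 (by positivity) (hb j₀).1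
      have hsum : ε ^ h * (1 / (2 * K)) - n * (K * ε ^ (h + 1)) ≤
          ∑ j, b j * (1 - ε ^ (h + 1) - (1 - ε ^ (H.dist j v + 1))) := by
        rw [← Finset.add_sum_erase _ _ (Finset.mem_univ j₀)]
        have := Finset.card_nsmul_le_sum (Finset.univ.erase j₀) _ _ fun j _ => hterm j
        rw [nsmul_eq_mul] at this
        have hcard : ((Finset.univ.erase j₀).card : ℝ) ≤ n := by
          rw [hn]
          exact_mod_cast Finset.card_le_univ _
        have := mul_le_mul_of_nonneg_right hcard (mul_pos hK (hpow (h + 1))).le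
        linarith
      linarith

end CirclePacking
end

noncomputable section

namespace CirclePacking

open Set Filter Metric

variable {V : Type*}

/-! ### Triangles and nondegenerate edges -/

section Triangles

variable [DecidableEq V] {T : AbstractSimplicialComplex V} {Φ : Sym2 V → ℝ} {i j k : V}

theorem IsTriangle.swap_right (h : IsTriangle T i j k) : IsTriangle T i k j :=
  ⟨h.2.1, h.1, h.2.2.1.symm, by rw [Finset.pair_comm k j]; exact h.2.2.2⟩

theorem IsTriangle.swap_left (h : IsTriangle T i j k) : IsTriangle T j i k :=
  ⟨h.1.symm, h.2.2.1, h.2.1, by rw [Finset.insert_comm]; exact h.2.2.2⟩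

theorem IsTriangle.adj (h : IsTriangle T i j k) : (edgeGraph T).Adj i j := by
  refine ⟨h.1, (T.isRelLowerSet_faces h.2.2.2).2 ?_ (Finset.insert_nonempty _ _)⟩
  intro a ha
  simp only [Finset.mem_insert, Finset.mem_singleton] at ha ⊢
  tauto

theorem IsWeight.cos_mem (hΦ : IsWeight T Φ) (h : (edgeGraph T).Adj i j) :
    Real.cos (Φ s(i, j)) ∈ Icc (0 : ℝ) 1 := by
  have := hΦ i j h
  exact ⟨Real.cos_nonneg_of_mem_Icc ⟨by linarith [this.1, Real.pi_pos], this.2⟩, Real.cos_le_one _⟩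

theorem IsWeight.cos_mem_of_isTriangle (hΦ : IsWeight T Φ) (h : IsTriangle T i j k) :
    Real.cos (Φ s(j, k)) ∈ Icc (0 : ℝ) 1 ∧ Real.cos (Φ s(i, k)) ∈ Icc (0 : ℝ) 1 ∧
      Real.cos (Φ s(i, j)) ∈ Icc (0 : ℝ) 1 :=
  ⟨hΦ.cos_mem h.swap_left.swap_right.adj, hΦ.cos_mem h.swap_right.adj, hΦ.cos_mem h.adj⟩

/-- In the triangle `ijk` the circles at `i`, `j` are tangent, and both are orthogonal to the circle
at `k`; the angle at `i` does then not depend on the radius at `j`. -/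
def IsDegenerate (Φ : Sym2 V → ℝ) (i j k : V) : Prop :=
  Real.cos (Φ s(i, j)) = 1 ∧ Real.cos (Φ s(j, k)) = 0 ∧ Real.cos (Φ s(i, k)) = 0

/-- The graph of the edges that are nondegenerate in some triangle. -/
def nondegenerateGraph (T : AbstractSimplicialComplex V) (Φ : Sym2 V → ℝ) : SimpleGraph V where
  Adj i j := ∃ k, IsTriangle T i j k ∧ ¬IsDegenerate Φ i j k
  symm := ⟨fun i j ⟨k, hk, hd⟩ => ⟨k, hk.swap_left, fun h =>
    hd ⟨by rw [Sym2.eq_swap]; exact h.1, h.2.2, h.2.1⟩⟩⟩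
  loopless := ⟨fun _ ⟨_, h, _⟩ => h.1 rfl⟩

theorem IsClosedSurface.exists_isTriangle (hT : IsClosedSurface T) (h : (edgeGraph T).Adj i j) :
    ∃ k, IsTriangle T i j k := by
  have := hT.link_degree i ⟨j, h⟩
  obtain ⟨k, hk⟩ := nonempty_of_ncard_ne_zero (by rw [this]; norm_num)
  exact ⟨k, hk⟩

/-- If `ij` is degenerate in the triangle `ijk`, the cosines on `ik` and `jk` are 0 and not 1, so
both these edges are nondegenerate and give a detour from `i` to `j`. -/
theorem nondegenerateGraph_preconnected (hT : IsClosedSurface T) (Φ : Sym2 V → ℝ) :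
    (nondegenerateGraph T Φ).Preconnected := by
  have hadj : ∀ i j, (edgeGraph T).Adj i j → (nondegenerateGraph T Φ).Reachable i j := by
    intro i j h
    obtain ⟨k, hk⟩ := hT.exists_isTriangle h
    by_cases hd : IsDegenerate Φ i j k
    · have h1 : (nondegenerateGraph T Φ).Adj i k :=
        ⟨j, hk.swap_right, fun h' => zero_ne_one (hd.2.2.symm.trans h'.1)⟩
      have h2 : (nondegenerateGraph T Φ).Adj j k :=
        ⟨i, hk.swap_left.swap_right, fun h' => zero_ne_one (hd.2.1.symm.trans h'.1)⟩
      exact h1.reachable.trans h2.symm.reachable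
    · exact SimpleGraph.Adj.reachable ⟨k, hk, hd⟩
  intro i j
  obtain ⟨p⟩ := hT.connected.preconnected i j
  induction p with
  | nil => rfl
  | cons h _ ih => exact (hadj _ _ h).trans ih

end Triangles

/-! ### The inner angles in logarithmic coordinates -/

theorem sq_edgeLength {Φ : Sym2 V → ℝ} {r : V → ℝ} (hr : IsCirclePackingMetric r) {i j : V}
    (h : 0 ≤ Real.cos (Φ s(i, j))) : edgeLength Φ r i j ^ 2 =
      r i ^ 2 + r j ^ 2 + 2 * r i * r j * Real.cos (Φ s(i, j)) := by
  have h1 := hr i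
  have h2 := hr j
  exact Real.sq_sqrt (by positivity)

theorem edgeLength_eq {Φ : Sym2 V → ℝ} {r : V → ℝ} (hr : IsCirclePackingMetric r) (i j : V) :
    edgeLength Φ r i j =
      r i * √(1 + (r j / r i) ^ 2 + 2 * (r j / r i) * Real.cos (Φ s(i, j))) := by
  have h1 := hr i
  rw [edgeLength, ← Real.sqrt_sq h1.le, ← Real.sqrt_mul (sq_nonneg _), Real.sqrt_sq h1.le]
  congr 1
  field_simp

theorem isCirclePackingMetric_exp (u : V → ℝ) :
    IsCirclePackingMetric fun v => Real.exp (u v) := fun _ => Real.exp_pos _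

theorem exp_log_of_isCirclePackingMetric {r : V → ℝ} (hr : IsCirclePackingMetric r) :
    (fun v => Real.exp (Real.log (r v))) = r :=
  funext fun v => Real.exp_log (hr v)

theorem ConvergesExponentially.eq_of_const {r rbar : V → ℝ}
    (h : ConvergesExponentially (fun _ => r) rbar) : r = rbar := by
  obtain ⟨C, -, c, hc, h⟩ := h
  funext i
  have h1 : Tendsto (fun t : ℝ => C * Real.exp (-c * t)) atTop (𝓝 (C * 0)) :=
    (Real.tendsto_exp_atBot.comp (tendsto_id.const_mul_atTop_of_neg (by linarith))).const_mul C
  rw [mul_zero] at h1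
  have h2 : |r i - rbar i| ≤ 0 :=
    ge_of_tendsto h1 (by filter_upwards [eventually_ge_atTop 0] with t ht using h t ht i)
  exact sub_eq_zero.1 (abs_nonpos_iff.1 h2)

variable [DecidableEq V]

theorem innerAngle_eq_triAngle {T : AbstractSimplicialComplex V} {Φ : Sym2 V → ℝ}
    (hΦ : IsWeight T Φ) {r : V → ℝ} (hr : IsCirclePackingMetric r) {i j k : V}
    (h : IsTriangle T i j k) :
    innerAngle Φ r i j k = triAngle (Real.cos (Φ s(j, k))) (Real.cos (Φ s(i, k)))
      (Real.cos (Φ s(i, j))) (r j / r i) (r k / r i) := by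
  obtain ⟨hα, hβ, hγ⟩ := hΦ.cos_mem_of_isTriangle h
  have hi := hr i
  have hj := hr j
  have hk := hr k
  have hb : 0 < r j / r i := by positivity
  have hc : 0 < r k / r i := by positivity
  rw [triAngle, ← arccos_div_sqrt (sq_side_pos hγ hb) (sq_side_pos hβ hc)
    (angleDisc_pos hα hβ hγ hb hc) (angleDisc_add_sq _ _ _ _ _), innerAngle,
    sq_edgeLength hr hα.1, sq_edgeLength hr hβ.1, sq_edgeLength hr hγ.1,
    edgeLength_eq hr i j, edgeLength_eq hr i k]
  have hP := Real.sqrt_pos.2 (sq_side_pos hγ hb)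
  have hQ := Real.sqrt_pos.2 (sq_side_pos hβ hc)
  congr 1
  rw [angleNum]
  generalize √(1 + (r j / r i) ^ 2 + 2 * (r j / r i) * Real.cos (Φ s(i, j))) = P at *
  generalize √(1 + (r k / r i) ^ 2 + 2 * (r k / r i) * Real.cos (Φ s(i, k))) = Q at *
  field_simp
  ring

theorem innerAngle_exp {T : AbstractSimplicialComplex V} {Φ : Sym2 V → ℝ}
    (hΦ : IsWeight T Φ) (u : V → ℝ) {i j k : V} (h : IsTriangle T i j k) :
    innerAngle Φ (fun v => Real.exp (u v)) i j k =
      triAngle (Real.cos (Φ s(j, k))) (Real.cos (Φ s(i, k))) (Real.cos (Φ s(i, j)))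
        (Real.exp (u j - u i)) (Real.exp (u k - u i)) := by
  rw [innerAngle_eq_triAngle hΦ (isCirclePackingMetric_exp u) h, Real.exp_sub, Real.exp_sub]

/-- A lower bound for `A` alone is enough: the sum over ordered pairs also meets the triangle with
`j` and `k` exchanged. -/
theorem exists_innerAngle_exp_sub_eq {T : AbstractSimplicialComplex V} {Φ : Sym2 V → ℝ}
    (hΦ : IsWeight T Φ) (ℓ : V → ℝ) (M : ℝ) {i j k : V} (h : IsTriangle T i j k) :
    ∃ K, 0 < K ∧ ∀ x : V → ℝ, (∀ v, |x v| ≤ M) → ∃ A B, 0 ≤ A ∧ A ≤ K ∧ 0 ≤ B ∧ B ≤ K ∧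
      (¬IsDegenerate Φ i j k → 1 ≤ K * A) ∧
      innerAngle Φ (fun v => Real.exp (ℓ v + x v)) i j k -
        innerAngle Φ (fun v => Real.exp (ℓ v)) i j k = A * (x j - x i) + B * (x k - x i) := by
  obtain ⟨hα, hβ, hγ⟩ := hΦ.cos_mem_of_isTriangle h
  -- Bounds the logarithms of all radius ratios that occur.
  set N := |ℓ j - ℓ i| + |ℓ k - ℓ i| + 2 * M with hN
  obtain ⟨K₁, hK₁, h₁⟩ := exists_triAngle_exp_sub_eq hα hβ hγ N
  obtain ⟨K₂, hK₂, h₂⟩ := exists_triAngle_exp_sub_eq hα hγ hβ N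
  refine ⟨max K₁ K₂, lt_max_of_lt_left hK₁, fun x hx => ?_⟩
  have hM : 0 ≤ M := (abs_nonneg _).trans (hx i)
  have hi := abs_le.1 (hx i)
  have hj := abs_le.1 (hx j)
  have hk := abs_le.1 (hx k)
  have aj := abs_nonneg (ℓ j - ℓ i)
  have ak := abs_nonneg (ℓ k - ℓ i)
  have hj' := abs_le.1 (le_refl |ℓ j - ℓ i|)
  have hk' := abs_le.1 (le_refl |ℓ k - ℓ i|)
  have hp : ℓ j + x j - (ℓ i + x i) ∈ Icc (-N) N := ⟨by linarith, by linarith⟩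
  have hq : ℓ k + x k - (ℓ i + x i) ∈ Icc (-N) N := ⟨by linarith, by linarith⟩
  have hp₀ : ℓ j - ℓ i ∈ Icc (-N) N := ⟨by linarith, by linarith⟩
  have hq₀ : ℓ k - ℓ i ∈ Icc (-N) N := ⟨by linarith, by linarith⟩
  -- One variable at a time: the ratio at `j` changes with that at `k` already displaced, then the
  -- ratio at `k` changes with that at `j` at its base value.
  obtain ⟨A, hA0, hA1, hA2, hA⟩ := h₁ _ hp _ hp₀ _ hq
  obtain ⟨B, hB0, hB1, -, hB⟩ := h₂ _ hq _ hq₀ _ hp₀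
  refine ⟨A, B, hA0, hA1.trans (le_max_left _ _), hB0, hB1.trans (le_max_right _ _),
    fun hd => (hA2 hd).trans (mul_le_mul_of_nonneg_right (le_max_left _ _) hA0), ?_⟩
  rw [innerAngle_exp hΦ _ h, innerAngle_exp hΦ _ h]
  rw [triAngle_swap _ _ _ (Real.exp (ℓ k + x k - (ℓ i + x i))),
    triAngle_swap _ _ _ (Real.exp (ℓ k - ℓ i))] at hB
  linear_combination hA + hB

/-! ### The curvature difference as a weighted Laplacian -/

variable [Fintype V]

open Classical in
theorem exists_uniform_innerAngle_exp_sub_eq {T : AbstractSimplicialComplex V} {Φ : Sym2 V → ℝ}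
    (hΦ : IsWeight T Φ) (ℓ : V → ℝ) (M : ℝ) :
    ∃ K, 0 < K ∧ ∀ x : V → ℝ, (∀ v, |x v| ≤ M) → ∀ i j k, ∃ A B, 0 ≤ A ∧ A ≤ K ∧ 0 ≤ B ∧ B ≤ K ∧
      (IsTriangle T i j k → ¬IsDegenerate Φ i j k → 1 ≤ K * A) ∧
      (if IsTriangle T i j k then innerAngle Φ (fun v => Real.exp (ℓ v + x v)) i j k else 0) -
        (if IsTriangle T i j k then innerAngle Φ (fun v => Real.exp (ℓ v)) i j k else 0) =
          A * (x j - x i) + B * (x k - x i) := by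
  have hex : ∀ z : V × V × V, ∃ K, 0 < K ∧ ∀ x : V → ℝ, (∀ v, |x v| ≤ M) → ∃ A B, 0 ≤ A ∧ A ≤ K ∧
      0 ≤ B ∧ B ≤ K ∧
      (IsTriangle T z.1 z.2.1 z.2.2 → ¬IsDegenerate Φ z.1 z.2.1 z.2.2 → 1 ≤ K * A) ∧
      (if IsTriangle T z.1 z.2.1 z.2.2 then
          innerAngle Φ (fun v => Real.exp (ℓ v + x v)) z.1 z.2.1 z.2.2 else 0) -
        (if IsTriangle T z.1 z.2.1 z.2.2 then
          innerAngle Φ (fun v => Real.exp (ℓ v)) z.1 z.2.1 z.2.2 else 0) =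
          A * (x z.2.1 - x z.1) + B * (x z.2.2 - x z.1) := by
    rintro ⟨i, j, k⟩
    by_cases h : IsTriangle T i j k
    · obtain ⟨K, hK, hx⟩ := exists_innerAngle_exp_sub_eq hΦ ℓ M h
      refine ⟨K, hK, fun x hxM => ?_⟩
      obtain ⟨A, B, h1, h2, h3, h4, h5, h6⟩ := hx x hxM
      exact ⟨A, B, h1, h2, h3, h4, fun _ => h5, by simpa only [if_pos h] using h6⟩
    · exact ⟨1, one_pos, fun x _ => ⟨0, 0, le_rfl, zero_le_one, le_rfl, zero_le_one,
        fun h' => absurd h' h, by simp [h]⟩⟩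
  choose K hK0 hK using hex
  obtain ⟨C, hC⟩ := Finite.exists_le K
  refine ⟨max C 1, by positivity, fun x hx i j k => ?_⟩
  have hle := (hC (i, j, k)).trans (le_max_left C 1)
  obtain ⟨A, B, h1, h2, h3, h4, h5, h6⟩ := hK (i, j, k) x hx
  exact ⟨A, B, h1, h2.trans hle, h3, h4.trans hle,
    fun h h' => (h5 h h').trans (mul_le_mul_of_nonneg_right hle h1), h6⟩

/-- The difference of the curvatures of two metrics is a weighted Laplacian of the difference of
their logarithms. -/
theorem exists_gaussCurvature_exp_sub_eq {T : AbstractSimplicialComplex V} {Φ : Sym2 V → ℝ}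
    (hΦ : IsWeight T Φ) (ℓ : V → ℝ) (M : ℝ) :
    ∃ K, 0 < K ∧ ∀ x : V → ℝ, (∀ v, |x v| ≤ M) → ∀ i, ∃ w : V → ℝ, (∀ j, 0 ≤ w j ∧ w j ≤ K) ∧
      (∀ j, (nondegenerateGraph T Φ).Adj i j → 1 ≤ K * w j) ∧
      gaussCurvature T Φ (fun v => Real.exp (ℓ v + x v)) i -
        gaussCurvature T Φ (fun v => Real.exp (ℓ v)) i = ∑ j, w j * (x i - x j) := by
  classical
  obtain ⟨K, hK, hx⟩ := exists_uniform_innerAngle_exp_sub_eq hΦ ℓ M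
  have hn : (0 : ℝ) ≤ Fintype.card V := Nat.cast_nonneg _
  -- The weights are halved sums of `card V` terms `A + B ≤ 2K`, whence `card V * K` from above; the
  -- halving costs the factor 2 in the lower bound.
  refine ⟨(Fintype.card V + 2) * K, by positivity, fun x hxM i => ?_⟩
  choose A B hA0 hAK hB0 hBK hA1 hAB using hx x hxM i
  have hAS : ∀ j k, A j k ≤ ∑ k, (A j k + B k j) := fun j k =>
    (le_add_of_nonneg_right (hB0 k j)).trans (Finset.single_le_sum
      (f := fun k => A j k + B k j) (fun k _ => add_nonneg (hA0 j k) (hB0 k j)) (Finset.mem_univ k))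
  refine ⟨fun j => 1 / 2 * ∑ k, (A j k + B k j), fun j => ⟨?_, ?_⟩, ?_, ?_⟩
  · exact mul_nonneg (by norm_num) (Finset.sum_nonneg fun k _ => add_nonneg (hA0 j k) (hB0 k j))
  · have := Finset.sum_le_card_nsmul Finset.univ (fun k => A j k + B k j) (K + K)
      fun k _ => add_le_add (hAK j k) (hBK k j)
    rw [nsmul_eq_mul, Finset.card_univ] at this
    linarith
  · rintro j ⟨k, hk, hd⟩
    have h1 := hA1 j k hk hd
    have h2 := mul_le_mul_of_nonneg_left (hAS j k) hK.le
    have h3 : 0 ≤ Fintype.card V * (K * ∑ k, (A j k + B k j)) :=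
      mul_nonneg hn ((mul_nonneg hK.le (hA0 j k)).trans h2)
    linarith
  · have hsum : (∑ j, ∑ k, if IsTriangle T i j k then
          innerAngle Φ (fun v => Real.exp (ℓ v + x v)) i j k else 0) -
        (∑ j, ∑ k, if IsTriangle T i j k then
          innerAngle Φ (fun v => Real.exp (ℓ v)) i j k else 0) =
        ∑ j, ∑ k, (A j k * (x j - x i) + B j k * (x k - x i)) := by
      rw [← Finset.sum_sub_distrib]
      refine Finset.sum_congr rfl fun j _ => ?_
      rw [← Finset.sum_sub_distrib]
      exact Finset.sum_congr rfl fun k _ => hAB j k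
    have hsym : ∑ j, ∑ k, (A j k * (x j - x i) + B j k * (x k - x i)) =
        -∑ j, (∑ k, (A j k + B k j)) * (x i - x j) := by
      simp only [Finset.sum_add_distrib, add_mul]
      rw [Finset.sum_comm (f := fun j k => B j k * (x k - x i)), neg_add, ← Finset.sum_neg_distrib,
        ← Finset.sum_neg_distrib]
      congr 1 <;> refine Finset.sum_congr rfl fun j _ => ?_ <;>
        rw [Finset.sum_mul, ← Finset.sum_neg_distrib] <;>
        exact Finset.sum_congr rfl fun k _ => by ring
    simp only [gaussCurvature]
    simp only [mul_assoc (1 / 2 : ℝ), ← Finset.mul_sum]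
    convert (congrArg (fun s => -(1 / 2 : ℝ) * s) (hsum.trans hsym)) using 1 <;> ring

end CirclePacking
end

noncomputable section

namespace CirclePacking

open Set Filter Metric

variable {V : Type*} [DecidableEq V] [Fintype V] {T : AbstractSimplicialComplex V} {Φ : Sym2 V → ℝ}

/-! ### The flow in logarithmic coordinates -/

/-- The vector field of the modified flow in the coordinates `u_i = log r_i`. -/
def logField (T : AbstractSimplicialComplex V) (Φ : Sym2 V → ℝ) (Rbar : V → ℝ) (u : V → ℝ)
    (i : V) : ℝ :=
  1 / 2 * (Rbar i - curvature T Φ (fun v => Real.exp (u v)) i)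

theorem contDiff_logField (hΦ : IsWeight T Φ) (Rbar : V → ℝ) :
    ContDiff ℝ 1 (logField T Φ Rbar) := by
  rw [contDiff_pi]
  intro i
  unfold logField curvature gaussCurvature
  refine contDiff_const.mul (contDiff_const.sub (ContDiff.div (contDiff_const.sub
    (contDiff_const.mul (ContDiff.sum fun j _ => ContDiff.sum fun k _ => ?_))) (by fun_prop)
      fun u => (pow_pos (Real.exp_pos _) 2).ne'))
  by_cases h : IsTriangle T i j k
  · obtain ⟨hα, hβ, hγ⟩ := hΦ.cos_mem_of_isTriangle h
    simp only [if_pos h, innerAngle_exp hΦ _ h]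
    exact (contDiff_triAngle_exp hα hβ hγ).comp
      (f := fun u : V → ℝ => (u j - u i, u k - u i)) (by fun_prop)
  · simp only [if_neg h]
    exact contDiff_const

theorem IsModifiedRicciFlow.hasDerivWithinAt_log {Rbar : V → ℝ} {I : Set ℝ} {r : ℝ → V → ℝ}
    (h : IsModifiedRicciFlow T Φ Rbar I r) {t : ℝ} (ht : t ∈ I) :
    HasDerivWithinAt (fun t v => Real.log (r t v))
      (logField T Φ Rbar fun v => Real.log (r t v)) I t := by
  obtain ⟨hr, hd⟩ := h t ht
  rw [hasDerivWithinAt_pi]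
  intro i
  have hri := hr i
  have h1 := ((hd i).log (by positivity)).const_mul (1 / 2 : ℝ)
  have h2 : (fun s => 1 / 2 * Real.log (r s i ^ 2)) = fun s => Real.log (r s i) := by
    funext s
    rw [Real.log_pow]
    push_cast
    ring
  rw [h2] at h1
  refine h1.congr_deriv ?_
  rw [logField, exp_log_of_isCirclePackingMetric hr]
  field_simp

theorem isModifiedRicciFlow_exp {Rbar : V → ℝ} {I : Set ℝ} {u : ℝ → V → ℝ}
    (h : ∀ t ∈ I, HasDerivWithinAt u (logField T Φ Rbar (u t)) I t) :
    IsModifiedRicciFlow T Φ Rbar I fun t v => Real.exp (u t v) := by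
  refine fun t ht => ⟨isCirclePackingMetric_exp _, fun i => ?_⟩
  refine (((hasDerivWithinAt_pi.1 (h t ht) i).exp).pow 2).congr_deriv ?_
  rw [logField]
  push_cast
  ring

theorem IsModifiedRicciFlow.mono {Rbar : V → ℝ} {I J : Set ℝ} {r : ℝ → V → ℝ}
    (h : IsModifiedRicciFlow T Φ Rbar I r) (hJ : J ⊆ I) : IsModifiedRicciFlow T Φ Rbar J r :=
  fun t ht => ⟨(h t (hJ ht)).1, fun i => ((h t (hJ ht)).2 i).mono hJ⟩

theorem IsModifiedRicciFlow.eqOn (hΦ : IsWeight T Φ) {Rbar : V → ℝ} {τ : ℝ} {r s : ℝ → V → ℝ}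
    (hr : IsModifiedRicciFlow T Φ Rbar (Ico 0 τ) r) (hs : IsModifiedRicciFlow T Φ Rbar (Ico 0 τ) s)
    (h0 : r 0 = s 0) : EqOn r s (Ico 0 τ) := by
  intro t ht
  have := eqOn_of_contDiff_of_hasDerivWithinAt (contDiff_logField hΦ Rbar)
    (fun t ht => hr.hasDerivWithinAt_log ht) (fun t ht => hs.hasDerivWithinAt_log ht)
    (by simp only [h0]) ht
  funext v
  exact Real.log_injOn_pos ((hr t ht).1 v) ((hs t ht).1 v) (congrFun this v)

/-- Both `log r_i` and its derivative converge, so the derivative tends to 0 and the limit is an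
equilibrium. -/
theorem IsConvergentModifiedRicciFlow.isAdmissible (hΦ : IsWeight T Φ) {Rbar : V → ℝ}
    {r : ℝ → V → ℝ} (h : IsConvergentModifiedRicciFlow T Φ Rbar r) : IsAdmissible T Φ Rbar := by
  obtain ⟨hr, q, hq, hlim⟩ := h
  refine ⟨q, hq, fun i => ?_⟩
  have hri : ∀ j, Tendsto (fun t => r t j) atTop (𝓝 (q j)) := tendsto_pi_nhds.1 hlim
  have hlog : Tendsto (fun t v => Real.log (r t v)) atTop (𝓝 fun v => Real.log (q v)) :=
    tendsto_pi_nhds.2 fun v => (hri v).log (hq v).ne'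
  have hfield := tendsto_pi_nhds.1
    (((contDiff_logField hΦ Rbar).continuous.tendsto _).comp hlog) i
  have hderiv : ∀ t ∈ Ici (0 : ℝ), HasDerivWithinAt (fun t => Real.log (r t i))
      (logField T Φ Rbar (fun v => Real.log (r t v)) i) (Ici 0) t := fun t ht =>
    hasDerivWithinAt_pi.1 (hr.hasDerivWithinAt_log ht) i
  have := eq_zero_of_tendsto_of_tendsto_deriv hderiv (tendsto_pi_nhds.1 hlog i) hfield
  rw [logField, exp_log_of_isCirclePackingMetric hq] at this
  linarith

/-- `κ` is a secant slope of `1 - exp (-2y)`, whose derivative is at least `2 exp (-2M)` on `[-M,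
M]`. It yields the restoring coefficient `a = -Rbar_i κ / 2`. -/
theorem exists_one_sub_exp_eq {M y : ℝ} (hy : |y| ≤ M) :
    ∃ κ, 2 * Real.exp (-2 * M) ≤ κ ∧ 1 - Real.exp (-2 * y) = κ * y := by
  obtain ⟨h1, h2⟩ := abs_le.1 hy
  rcases lt_trichotomy y 0 with h | h | h
  · refine ⟨(1 - Real.exp (-2 * y)) / y, ?_, (div_mul_cancel₀ _ h.ne).symm⟩
    rw [le_div_iff_of_neg h]
    have h3 := Real.add_one_le_exp (-2 * y)
    have h4 : Real.exp (-2 * M) ≤ 1 := Real.exp_le_one_iff.2 (by linarith)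
    nlinarith
  · exact ⟨_, le_rfl, by simp [h]⟩
  · refine ⟨(1 - Real.exp (-2 * y)) / y, ?_, by field_simp⟩
    rw [le_div_iff₀ h]
    have h3 := Real.add_one_le_exp (2 * y)
    have h4 : Real.exp (-2 * M) ≤ Real.exp (-2 * y) := Real.exp_le_exp.2 (by linarith)
    have h5 : Real.exp (-2 * y) * Real.exp (2 * y) = 1 := by
      rw [← Real.exp_add]
      simp
    nlinarith [Real.exp_pos (-2 * y)]

/-- Near an equilibrium with nonpositive curvature the flow is linear with a diagonally dominant
matrix that depends on the point. -/
theorem exists_logField_eq (hΦ : IsWeight T Φ) {Rbar ℓ : V → ℝ}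
    (hℓ : ∀ i, curvature T Φ (fun v => Real.exp (ℓ v)) i = Rbar i) (hR : ∀ i, Rbar i ≤ 0) {v₀ : V}
    (hv₀ : Rbar v₀ < 0) (M : ℝ) :
    ∃ K, 0 < K ∧ ∀ x : V → ℝ, (∀ v, |x v| ≤ M) → ∀ i, ∃ a, 0 ≤ a ∧ ∃ b : V → ℝ,
      (∀ j, 0 ≤ b j ∧ b j ≤ K) ∧ (i = v₀ → 1 ≤ K * a) ∧
      (∀ j, (nondegenerateGraph T Φ).Adj i j → 1 ≤ K * b j) ∧
      logField T Φ Rbar (ℓ + x) i = -(a * x i) - ∑ j, b j * (x i - x j) := by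
  obtain ⟨K, hK, hx⟩ := exists_gaussCurvature_exp_sub_eq hΦ ℓ M
  obtain ⟨L, hL⟩ := Finite.exists_le fun v => |ℓ v|
  set E := Real.exp (2 * (L + M)) with hE
  have hE0 : 0 < E := Real.exp_pos _
  have hQ : 0 < Real.exp (2 * M) / -Rbar v₀ := div_pos (Real.exp_pos _) (by linarith)
  refine ⟨2 * K * E + Real.exp (2 * M) / -Rbar v₀, by positivity, fun x hxM i => ?_⟩
  obtain ⟨w, hw, hadj, hdiff⟩ := hx x hxM i
  obtain ⟨κ, hκ, hκe⟩ := exists_one_sub_exp_eq (hxM i)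
  have hκ0 : 0 ≤ κ := le_trans (by positivity) hκ
  set e := Real.exp (-2 * (ℓ i + x i)) with he
  have he0 : 0 < e := Real.exp_pos _
  have h1 := abs_le.1 (hL i)
  have h2 := abs_le.1 (hxM i)
  have heE : e ≤ E := Real.exp_le_exp.2 (by linarith)
  have hEe : 1 ≤ E * e := by
    rw [hE, he, ← Real.exp_add]
    exact Real.one_le_exp (by linarith)
  -- From `R_i(ℓ + x) = Rbar_i exp (-2 x_i) + e ∑ w_j (x_i - x_j)`, the field is `Rbar_i (1 - exp
  -- (-2 x_i)) / 2 - (e / 2) ∑ w_j (x_i - x_j)`. The sign of `Rbar` makes `a` nonnegative.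
  refine ⟨1 / 2 * -Rbar i * κ, mul_nonneg (by linarith [hR i]) hκ0, fun j => 1 / 2 * e * w j,
    fun j => ⟨mul_nonneg (by positivity) (hw j).1, ?_⟩, ?_, fun j hj => ?_, ?_⟩
  · have h3 : e * w j ≤ E * K := mul_le_mul heE (hw j).2 (hw j).1 hE0.le
    nlinarith [mul_pos hK hE0]
  · rintro rfl
    have h3 : 1 ≤ Real.exp (2 * M) / -Rbar i * (1 / 2 * -Rbar i * κ) := by
      have h4 : Real.exp (2 * M) * Real.exp (-2 * M) = 1 := by
        rw [← Real.exp_add]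
        simp
      have h5 : Real.exp (2 * M) / -Rbar i * (1 / 2 * -Rbar i * κ) =
          Real.exp (2 * M) * κ / 2 := by
        have : Rbar i ≠ 0 := hv₀.ne
        field_simp
      rw [h5]
      nlinarith [Real.exp_pos (2 * M)]
    have h6 : 0 ≤ 2 * K * E * (1 / 2 * -Rbar i * κ) :=
      mul_nonneg (by positivity) (mul_nonneg (by linarith [hR i]) hκ0)
    linarith
  · have h3 := hadj j hj
    have h4 : K * w j ≤ 2 * K * E * (1 / 2 * e * w j) := by
      have : 0 ≤ K * w j := mul_nonneg hK.le (hw j).1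
      calc K * w j ≤ (K * w j) * (E * e) := le_mul_of_one_le_right this hEe
        _ = _ := by ring
    have h6 : 0 ≤ Real.exp (2 * M) / -Rbar v₀ * (1 / 2 * e * w j) :=
      mul_nonneg hQ.le (mul_nonneg (by positivity) (hw j).1)
    linarith
  · have hsq : ∀ y : ℝ, (Real.exp y ^ 2)⁻¹ = Real.exp (-2 * y) := fun y => by
      rw [← Real.exp_nat_mul, ← Real.exp_neg]
      congr 1
      push_cast
      ring
    have hG : ∀ u : V → ℝ, curvature T Φ (fun v => Real.exp (u v)) i =
        gaussCurvature T Φ (fun v => Real.exp (u v)) i * Real.exp (-2 * u i) := fun u => by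
      rw [curvature, div_eq_mul_inv, hsq]
    have hb : ∑ j, 1 / 2 * e * w j * (x i - x j) = 1 / 2 * e * ∑ j, w j * (x i - x j) := by
      rw [Finset.mul_sum]
      exact Finset.sum_congr rfl fun j _ => by ring
    have hexp : e = Real.exp (-2 * x i) * Real.exp (-2 * ℓ i) := by
      rw [he, ← Real.exp_add]
      congr 1
      ring
    have h0 : gaussCurvature T Φ (fun v => Real.exp (ℓ v)) i * Real.exp (-2 * ℓ i) = Rbar i := by
      rw [← hG, hℓ]
    have h3 : gaussCurvature T Φ (fun v => Real.exp (ℓ v)) i * e =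
        Rbar i * Real.exp (-2 * x i) := by
      rw [hexp, ← h0]
      ring
    rw [hb, ← hdiff, logField, hG]
    simp only [Pi.add_apply]
    rw [← he]
    linear_combination (1 / 2) * Rbar i * hκe - (1 / 2) * h3

theorem exists_flow_of_curvature_nonpos (hT : IsClosedSurface T) (hΦ : IsWeight T Φ)
    {Rbar : V → ℝ} (hR : ∀ i, Rbar i ≤ 0) (hR0 : Rbar ≠ 0) {rbar : V → ℝ}
    (hrbar : IsCirclePackingMetric rbar) (hcurv : ∀ i, curvature T Φ rbar i = Rbar i) {r₀ : V → ℝ}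
    (hr₀ : IsCirclePackingMetric r₀) :
    ∃ r : ℝ → V → ℝ, IsModifiedRicciFlow T Φ Rbar (Ici 0) r ∧ r 0 = r₀ ∧
      ConvergesExponentially r rbar := by
  obtain ⟨v₀, hv₀⟩ : ∃ v, Rbar v < 0 := by
    by_contra! h
    exact hR0 (funext fun v => le_antisymm (hR v) (h v))
  set ℓ : V → ℝ := fun v => Real.log (rbar v) with hℓdef
  have hexpℓ : (fun v => Real.exp (ℓ v)) = rbar := exp_log_of_isCirclePackingMetric hrbar
  set x₀ : V → ℝ := (fun v => Real.log (r₀ v)) - ℓ with hx₀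
  -- As `φ ≥ 1 / 2`, the box `|x_j| ≤ m φ_j` contains `x₀`.
  set m : ℝ := 2 * ‖x₀‖ + 1 with hm
  have hm0 : 0 < m := by positivity
  obtain ⟨K, hK, hlin⟩ := exists_logField_eq hΦ (ℓ := ℓ) (by rw [hexpℓ]; exact hcurv) hR hv₀ m
  obtain ⟨δ, hδ, φ, hφ, hdom⟩ := exists_weights (nondegenerateGraph_preconnected hT Φ) v₀ hK
  have hφ0 : ∀ i, 0 < φ i := fun i => lt_of_lt_of_le (by norm_num) (hφ i).1
  have hbox : ∀ s, 0 < s → s ≤ m → ∀ x : V → ℝ, (∀ j, |x j| ≤ s * φ j) → ∀ j, |x j| ≤ m :=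
    fun s hs hsm x hx j => (hx j).trans
      ((mul_le_of_le_one_right hs.le (hφ j).2).trans hsm)
  have hF : ContDiff ℝ 1 fun x => logField T Φ Rbar (ℓ + x) :=
    (contDiff_logField hΦ Rbar).comp (contDiff_const.add contDiff_id)
  have hscale : ∀ s, 0 < s → ∀ i a (b : V → ℝ), δ ≤ a * φ i + ∑ j, b j * (φ i - φ j) →
      δ * (s * φ i) ≤ a * (s * φ i) + ∑ j, b j * (s * φ i - s * φ j) := by
    intro s hs i a b h
    have h1 : ∑ j, b j * (s * φ i - s * φ j) = s * ∑ j, b j * (φ i - φ j) := by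
      rw [Finset.mul_sum]
      exact Finset.sum_congr rfl fun j _ => by ring
    rw [h1]
    have h2 : δ * (s * φ i) ≤ s * δ := by
      have := mul_le_of_le_one_right (mul_pos hs hδ).le (hφ i).2
      linarith
    have h3 := mul_le_mul_of_nonneg_left h hs.le
    linarith
  obtain ⟨x, hx0, hx, hdecay⟩ := exists_exponentially_decaying_solution hF hm0 hδ hφ0
    (by
      intro s hs hsm x hx i hi
      obtain ⟨a, ha, b, hb, hav, hadj, he⟩ := hlin x (hbox s hs hsm x hx) i
      have h1 := hscale s hs i a b (hdom i a ha b hb hav hadj)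
      -- On the face `x_i = s φ_i` every other `x_j` is at most `s φ_j`, so the row inequality for
      -- `φ` bounds the field.
      have h2 : ∑ j, b j * (s * φ i - s * φ j) ≤ ∑ j, b j * (x i - x j) :=
        Finset.sum_le_sum fun j _ => mul_le_mul_of_nonneg_left
          (by linarith [(abs_le.1 (hx j)).2]) (hb j).1
      rw [he, hi] at *
      linarith)
    (by
      intro s hs hsm x hx i hi
      obtain ⟨a, ha, b, hb, hav, hadj, he⟩ := hlin x (hbox s hs hsm x hx) i
      have h1 := hscale s hs i a b (hdom i a ha b hb hav hadj)
      have h2 : ∑ j, b j * (s * φ i - s * φ j) ≤ -∑ j, b j * (x i - x j) := by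
        rw [← Finset.sum_neg_distrib]
        refine Finset.sum_le_sum fun j _ => ?_
        rw [← mul_neg]
        exact mul_le_mul_of_nonneg_left (by linarith [(abs_le.1 (hx j)).1]) (hb j).1
      rw [he, hi] at *
      linarith)
    x₀ (fun j => by
      have h1 := norm_le_pi_norm x₀ j
      rw [Real.norm_eq_abs] at h1
      have h2 := mul_le_mul_of_nonneg_left (hφ j).1 hm0.le
      linarith)
  refine ⟨fun t v => Real.exp ((ℓ + x t) v), isModifiedRicciFlow_exp fun t ht =>
    (hx t ht).const_add ℓ, ?_, ?_⟩
  · funext v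
    simp only [hx0, hx₀, add_sub_cancel]
    exact Real.exp_log (hr₀ v)
  · refine ⟨‖rbar‖ * Real.exp m * m + 1, by positivity, δ / 2, by positivity, fun t ht i => ?_⟩
    have h1 : |x t i| ≤ m * Real.exp (-(δ / 2) * t) :=
      (hdecay t ht i).trans (mul_le_of_le_one_right (by positivity) (hφ i).2)
    have h2 : |x t i| ≤ m := h1.trans (mul_le_of_le_one_right hm0.le
      (Real.exp_le_one_iff.2 (by have := mul_nonneg hδ.le ht; linarith)))
    have h3 : |Real.exp (x t i) - 1| ≤ Real.exp m * |x t i| := by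
      have h4 := Real.add_one_le_exp (x t i)
      have h5 := Real.add_one_le_exp (-x t i)
      have h6 : Real.exp (x t i) * Real.exp (-x t i) = 1 := by
        rw [← Real.exp_add]
        simp
      have h7 : Real.exp (x t i) ≤ Real.exp m := Real.exp_le_exp.2 ((le_abs_self _).trans h2)
      have h8 : 1 ≤ Real.exp m := Real.one_le_exp hm0.le
      have h9 := Real.exp_pos (x t i)
      rcases abs_cases (x t i) with ⟨h, h'⟩ | ⟨h, h'⟩ <;> rw [h] <;>
        refine abs_le.2 ⟨?_, ?_⟩ <;> nlinarith
    have h4 : Real.exp ((ℓ + x t) i) - rbar i = rbar i * (Real.exp (x t i) - 1) := by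
      rw [Pi.add_apply, Real.exp_add, congrFun hexpℓ i]
      ring
    rw [h4, abs_mul]
    have h5 : |rbar i| ≤ ‖rbar‖ := norm_le_pi_norm rbar i
    have h6 := (h3.trans (mul_le_mul_of_nonneg_left h1 (Real.exp_pos m).le))
    calc |rbar i| * |Real.exp (x t i) - 1|
        ≤ ‖rbar‖ * (Real.exp m * (m * Real.exp (-(δ / 2) * t))) :=
          mul_le_mul h5 h6 (abs_nonneg _) (norm_nonneg _)
      _ ≤ (‖rbar‖ * Real.exp m * m + 1) * Real.exp (-(δ / 2) * t) := by
          have := Real.exp_pos (-(δ / 2) * t)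
          linarith

theorem isModifiedRicciFlow_const {Rbar : V → ℝ} {r : V → ℝ} (hr : IsCirclePackingMetric r)
    (h : ∀ i, curvature T Φ r i = Rbar i) (I : Set ℝ) :
    IsModifiedRicciFlow T Φ Rbar I fun _ => r := fun t _ =>
  ⟨hr, fun i => by simpa [h i] using hasDerivWithinAt_const t I (r i ^ 2)⟩

end CirclePacking
end

/-! ### The theorem -/

theorem mainTheorem8 {V : Type*} [Fintype V] [DecidableEq V]
    (T : AbstractSimplicialComplex V) (hT : CirclePacking.IsClosedSurface T)
    (Φ : Sym2 V → ℝ) (hΦ : CirclePacking.IsWeight T Φ) (Rbar : V → ℝ) :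
    (∀ r : ℝ → V → ℝ, CirclePacking.IsConvergentModifiedRicciFlow T Φ Rbar r →
      CirclePacking.IsAdmissible T Φ Rbar) ∧
    ((∀ i, Rbar i ≤ 0) → Rbar ≠ 0 →
      ∀ rbar : V → ℝ, CirclePacking.IsCirclePackingMetric rbar →
        (∀ i, CirclePacking.curvature T Φ rbar i = Rbar i) →
        (∀ r : V → ℝ, CirclePacking.IsCirclePackingMetric r →
          (∀ i, CirclePacking.curvature T Φ r i = Rbar i) → r = rbar) ∧
        ∀ r₀ : V → ℝ, CirclePacking.IsCirclePackingMetric r₀ →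
          ∃ r : ℝ → V → ℝ,
            CirclePacking.IsModifiedRicciFlow T Φ Rbar (Set.Ici 0) r ∧ r 0 = r₀ ∧
            (∀ τ > 0, ∀ s : ℝ → V → ℝ,
              CirclePacking.IsModifiedRicciFlow T Φ Rbar (Set.Ico 0 τ) s → s 0 = r₀ →
              ∀ t ∈ Set.Ico 0 τ, s t = r t) ∧
            CirclePacking.ConvergesExponentially r rbar) := by
  refine ⟨fun r hr => hr.isAdmissible hΦ, fun hR hR0 rbar hrbar hcurv => ?_⟩
  have hflow : ∀ r₀ : V → ℝ, CirclePacking.IsCirclePackingMetric r₀ →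
      ∃ r : ℝ → V → ℝ,
        CirclePacking.IsModifiedRicciFlow T Φ Rbar (Set.Ici 0) r ∧ r 0 = r₀ ∧
        (∀ τ > 0, ∀ s : ℝ → V → ℝ,
          CirclePacking.IsModifiedRicciFlow T Φ Rbar (Set.Ico 0 τ) s → s 0 = r₀ →
          ∀ t ∈ Set.Ico 0 τ, s t = r t) ∧
        CirclePacking.ConvergesExponentially r rbar := by
    intro r₀ hr₀
    obtain ⟨r, hr, h0, hconv⟩ :=
      CirclePacking.exists_flow_of_curvature_nonpos hT hΦ hR hR0 hrbar hcurv hr₀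
    exact ⟨r, hr, h0, fun τ _ s hs hs0 =>
      hs.eqOn hΦ (hr.mono Set.Ico_subset_Ici_self) (hs0.trans h0.symm), hconv⟩
  refine ⟨fun q hq hqcurv => ?_, hflow⟩
  obtain ⟨r, -, -, huniq, C, hC, c, hc, hconv⟩ := hflow q hq
  refine CirclePacking.ConvergesExponentially.eq_of_const ⟨C, hC, c, hc, fun t ht i => ?_⟩
  -- The constant solution at `q` agrees with the convergent flow on `[0, t + 1)`, which contains
  -- `t`.
  rw [huniq (t + 1) (by linarith) (fun _ => q)
    (CirclePacking.isModifiedRicciFlow_const hq hqcurv _) rfl t ⟨ht, by linarith⟩]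
  exact hconv t ht i
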